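/- Let $n\ge 0$ be an integer and let $\mathrm{Lo}^1_{n+1}$ be the group of real lower triangular $(n+1)\times(n+1)$ matrices with all diagonal entries equal to $1$. For $k$-element subsets $\mathbf i_0=\{i_{01}<\dots<i_{0k}\}$ and $\mathbf i_1=\{i_{11}<\dots<i_{1k}\}$ of $\{1,\dots,n+1\}$, write $\mathbf i_0\ge\mathbf i_1$ if $i_{0a}\ge i_{1a}$ for all $a$. A matrix $L\in\mathrm{Lo}^1_{n+1}$ is *totally positive* if for every $1\le k\le n+1$ and all $k$-element subsets $\mathbf i_0\ge\mathbf i_1$ the minor of $L$ with rows $\mathbf i_0$ and columns $\mathbf i_1$ is positive. For $1\le j\le n$ let $\mathfrak l_j$ be the $(n+1)\times(n+1)$ matrix whose only nonzero entry is $(\mathfrak l_j)_{j+1,j}=1$. A map $\Gamma:[0,1]\to\mathrm{Lo}^1_{n+1}$ is a *convex curve* if it is absolutely continuous and, for every $t\in[0,1]$ at which the derivative $\Gamma'(t)$ exists (one-sided if $t\in\{0,1\}$), $\Gamma(t)^{-1}\Gamma'(t)=\sum_{j=1}^n\beta_j\,\mathfrak l_j$ for some real numbers $\beta_1,\dots,\beta_n>0$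 (depending on $t$). Let $L_0,L_1\in\mathrm{Lo}^1_{n+1}$. Then $L_0^{-1}L_1$ is totally positive if and only if there exists a convex curve $\Gamma:[0,1]\to\mathrm{Lo}^1_{n+1}$ with $\Gamma(0)=L_0$ and $\Gamma(1)=L_1$. -/

import Mathlib

/-- The group of real lower triangular `(n+1) × (n+1)` matrices with diagonal entries equal to 1,
as a set of matrices. -/
def unipotentLower (n : ℕ) : Set (Matrix (Fin (n + 1)) (Fin (n + 1)) ℝ) :=
  {L | (∀ i j, i < j → L i j = 0) ∧ ∀ i, L i i = 1}

/-- Elements of `unipotentLower n` have determinant 1, so that `L⁻¹` is their genuine inverse. -/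
theorem det_of_mem_unipotentLower {n : ℕ} {L : Matrix (Fin (n + 1)) (Fin (n + 1)) ℝ}
    (hL : L ∈ unipotentLower n) : L.det = 1 := by
  rw [Matrix.det_of_isLowerTriangular L (fun i j h => hL.1 i j h)]
  exact Finset.prod_eq_one fun i _ => hL.2 i

/-- The matrix whose only nonzero entry is a 1 just below the diagonal, in column `j`
(and row `j + 1`). -/
def subdiagonalUnit {n : ℕ} (j : Fin n) : Matrix (Fin (n + 1)) (Fin (n + 1)) ℝ :=
  Matrix.single j.succ j.castSucc 1

/-- Total positivity of a unipotent lower triangular matrix: all minors with row set `r` and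
column set `c` satisfying `r ≥ c` are positive. A `k`-element subset `{r 0 < ⋯ < r (k-1)}` of the
index set is given by its increasing enumeration `r`, and subsets of equal size are compared
entrywise. -/
def IsTotallyPositive {n : ℕ} (L : Matrix (Fin (n + 1)) (Fin (n + 1)) ℝ) : Prop :=
  L ∈ unipotentLower n ∧
    ∀ k : ℕ, 1 ≤ k → ∀ r c : Fin k ↪o Fin (n + 1), (∀ a, c a ≤ r a) →
      0 < (L.submatrix r c).det

/-- A convex curve `Γ : [a, b] → unipotentLower n` (only the values on `[a, b]` matter):
`Γ` is absolutely continuous and, at each `t ∈ [a, b]` where it has a derivative `D` (one-sided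
at the end points), the logarithmic derivative `Γ(t)⁻¹ D` is a linear combination with positive
coefficients of all the matrices `subdiagonalUnit j`. Absolute continuity and derivatives of
matrix-valued maps are taken entrywise. -/
def IsConvexCurve {n : ℕ} (Γ : ℝ → Matrix (Fin (n + 1)) (Fin (n + 1)) ℝ) (a b : ℝ) : Prop :=
  (∀ t ∈ Set.Icc a b, Γ t ∈ unipotentLower n) ∧
  (∀ i k, AbsolutelyContinuousOnInterval (fun t => Γ t i k) a b) ∧
  ∀ t ∈ Set.Icc a b, ∀ D : Matrix (Fin (n + 1)) (Fin (n + 1)) ℝ,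
    (∀ i k, HasDerivWithinAt (fun s => Γ s i k) (D i k) (Set.Icc a b) t) →
    ∃ β : Fin n → ℝ, (∀ j, 0 < β j) ∧ (Γ t)⁻¹ * D = ∑ j, β j • subdiagonalUnit j

/-! Right multiplication by `∑ j, β j • subdiagonalUnit j` shifts columns: along a convex curve the
columns of `(Γ 0)⁻¹ * Γ t` satisfy `w_j' = β_j w_{j+1}` almost everywhere. Hence the derivative of a
minor is a positive combination of the minors with one column index raised by one. Induction on the
distance of the column indices from the right edge gives first nonnegativity
(`colMinor_nonneg_of_curve`), then positivity for `t > 0` of the minors with columns below rows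
(`colMinor_pos_of_curve`).

Conversely, clearing the rows of a totally positive `L` from the bottom up by column operations with
positive multipliers factors `L` into matrices `1 + τ • subdiagonalUnit j`
(`IsFlagPositive.exists_factorization`). Switching on one letter `j` at a time follows this product
and ends at `L`, but its controls vanish most of the time, whereas convexity needs them all
positive. So a constant `δ > 0` is added to every control and the weights are corrected to keep the
endpoint. Column `j` of the endpoint depends only on controls of index at least `j`, and is affine
in the weights of letter `j` once those of larger index are fixed. At `δ = 0` this linear system is
triangular with nonzero diagonal, so for small `δ` it stays solvable, and the corrected weights tend
to `τ` and remain positive (`exists_weights`). -/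

/-! ### Absolutely continuous functions: monotonicity and determinants -/

open MeasureTheory in
theorem AbsolutelyContinuousOnInterval.monotoneOn_of_ae_hasDerivAt_nonneg {F : ℝ → ℝ} {a b : ℝ}
    (hab : a ≤ b) (hF : AbsolutelyContinuousOnInterval F a b)
    (h : ∀ᵐ t, t ∈ Set.Ioo a b → ∃ d, 0 ≤ d ∧ HasDerivAt F d t) :
    MonotoneOn F (Set.Icc a b) := by
  intro x hx y hy hxy
  have hsub : AbsolutelyContinuousOnInterval F x y := by
    refine hF.mono ?_
    rw [Set.uIcc_of_le hxy, Set.uIcc_of_le hab]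
    exact Set.Icc_subset_Icc hx.1 hy.2
  have key := hsub.integral_deriv_eq_sub
  have hb : ∀ᵐ t : ℝ, t ≠ b := by simp [ae_iff, measure_singleton]
  have : 0 ≤ ∫ t in x..y, deriv F t := by
    rw [intervalIntegral.integral_of_le hxy]
    refine setIntegral_nonneg_of_ae_restrict ?_
    rw [Filter.EventuallyLE, ae_restrict_iff' measurableSet_Ioc]
    filter_upwards [h, hb] with t ht htb htI
    obtain ⟨d, hd, hd'⟩ := ht ⟨hx.1.trans_lt htI.1, lt_of_le_of_ne (htI.2.trans hy.2) htb⟩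
    simpa [hd'.deriv] using hd
  linarith

open MeasureTheory in
-- If the end values agreed, monotonicity would make `F` constant on `[a, x]`, with zero derivative
-- inside. But almost every interior point has a positive derivative, and the interval has positive
-- measure.
theorem AbsolutelyContinuousOnInterval.lt_of_ae_hasDerivAt_pos {F : ℝ → ℝ} {a b x : ℝ}
    (hax : a < x) (hxb : x ≤ b) (hF : AbsolutelyContinuousOnInterval F a b)
    (h : ∀ᵐ t, t ∈ Set.Ioo a b → ∃ d, 0 < d ∧ HasDerivAt F d t) : F a < F x := by
  have hmono : MonotoneOn F (Set.Icc a b) :=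
    hF.monotoneOn_of_ae_hasDerivAt_nonneg (hax.le.trans hxb)
      (h.mono fun t ht hI => (ht hI).imp fun d hd => ⟨hd.1.le, hd.2⟩)
  have ha : a ∈ Set.Icc a b := ⟨le_rfl, hax.le.trans hxb⟩
  have hx : x ∈ Set.Icc a b := ⟨hax.le, hxb⟩
  refine lt_of_le_of_ne (hmono ha hx hax.le) fun heq => ?_
  have hne : (ae (volume.restrict (Set.Ioo a x))).NeBot := by
    rw [ae_neBot, Ne, Measure.restrict_eq_zero]
    simpa using hax
  obtain ⟨t, ht, htI⟩ := ((ae_restrict_of_ae h).and (ae_restrict_mem measurableSet_Ioo)).exists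
    (f := ae (volume.restrict (Set.Ioo a x)))
  obtain ⟨d, hd, hd'⟩ := ht ⟨htI.1, htI.2.trans_le hxb⟩
  have hconst : F =ᶠ[nhds t] fun _ => F a := by
    filter_upwards [isOpen_Ioo.mem_nhds htI] with s hs
    have hsI : s ∈ Set.Icc a b := ⟨hs.1.le, hs.2.le.trans hxb⟩
    exact le_antisymm ((hmono hsI hx hs.2.le).trans heq.ge) (hmono ha hsI hs.1.le)
  exact hd.ne ((hasDerivAt_const t (F a)).congr_of_eventuallyEq hconst |>.unique hd')

theorem AbsolutelyContinuousOnInterval.const {a b : ℝ} (x : ℝ) :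
    AbsolutelyContinuousOnInterval (fun _ => x) a b :=
  (LipschitzWith.const x).lipschitzOnWith.absolutelyContinuousOnInterval

theorem AbsolutelyContinuousOnInterval.fun_finset_sum {ι : Type*} (s : Finset ι) {f : ι → ℝ → ℝ}
    {a b : ℝ} (h : ∀ i ∈ s, AbsolutelyContinuousOnInterval (f i) a b) :
    AbsolutelyContinuousOnInterval (fun t => ∑ i ∈ s, f i t) a b := by
  classical
  induction s using Finset.induction_on with
  | empty => simpa using AbsolutelyContinuousOnInterval.const 0
  | insert i s hi ih =>
    simp only [Finset.sum_insert hi]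
    exact (h i (by simp)).fun_add (ih fun j hj => h j (by simp [hj]))

theorem AbsolutelyContinuousOnInterval.fun_finset_prod {ι : Type*} (s : Finset ι) {f : ι → ℝ → ℝ}
    {a b : ℝ} (h : ∀ i ∈ s, AbsolutelyContinuousOnInterval (f i) a b) :
    AbsolutelyContinuousOnInterval (fun t => ∏ i ∈ s, f i t) a b := by
  classical
  induction s using Finset.induction_on with
  | empty => simpa using AbsolutelyContinuousOnInterval.const 1
  | insert i s hi ih =>
    simp only [Finset.prod_insert hi]
    exact (h i (by simp)).fun_mul (ih fun j hj => h j (by simp [hj]))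

theorem AbsolutelyContinuousOnInterval.det {k : Type*} [Fintype k] [DecidableEq k]
    {A : ℝ → Matrix k k ℝ} {a b : ℝ}
    (h : ∀ i j, AbsolutelyContinuousOnInterval (fun t => A t i j) a b) :
    AbsolutelyContinuousOnInterval (fun t => (A t).det) a b := by
  simp only [Matrix.det_apply']
  exact fun_finset_sum _ fun σ _ => (fun_finset_prod _ fun i _ => h _ _).const_mul _

theorem HasDerivAt.matrix_det {k : Type*} [Fintype k] [DecidableEq k]
    {A : ℝ → Matrix k k ℝ} {A' : Matrix k k ℝ} {t : ℝ}
    (h : ∀ i j, HasDerivAt (fun s => A s i j) (A' i j) t) :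
    HasDerivAt (fun s => (A s).det) (∑ a, ((A t).updateCol a fun i => A' i a).det) t := by
  simp only [Matrix.det_apply']
  rw [Finset.sum_comm]
  refine HasDerivAt.fun_sum fun σ _ => ?_
  rw [← Finset.mul_sum]
  refine HasDerivAt.const_mul _ ?_
  convert! HasDerivAt.fun_finsetProd (u := Finset.univ) fun i _ => h (σ i) i using 1
  refine Finset.sum_congr rfl fun a _ => ?_
  rw [← Finset.prod_erase_mul _ _ (Finset.mem_univ a), smul_eq_mul]
  congr 1
  · refine Finset.prod_congr rfl fun i hi => ?_
    rw [Matrix.updateCol_ne (Finset.ne_of_mem_erase hi)]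
  · rw [Matrix.updateCol_self]

/-! ### Minors along a curve and their positivity -/

/-- The minor of the infinite-column array `W` with rows `r` and columns `c`. -/
def colMinor {ι : Type*} (W : ι → ℕ → ℝ) {k : ℕ} (r : Fin k → ι) (c : Fin k → ℕ) : ℝ :=
  (Matrix.of fun a b => W (r a) (c b)).det

theorem hasDerivAt_colMinor {ι : Type*} {W : ℝ → ι → ℕ → ℝ} {t : ℝ} {β : ℕ → ℝ}
    (h : ∀ i j, HasDerivAt (fun s => W s i j) (β j * W t i (j + 1)) t) {k : ℕ} (r : Fin k → ι)
    (c : Fin k → ℕ) :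
    HasDerivAt (fun s => colMinor (W s) r c)
      (∑ a, β (c a) * colMinor (W t) r (Function.update c a (c a + 1))) t := by
  convert! HasDerivAt.matrix_det (A := fun s => Matrix.of fun a b => W s (r a) (c b))
    (fun a b => h (r a) (c b)) using 1
  refine Finset.sum_congr rfl fun a _ => ?_
  have h1 := Matrix.det_updateCol_smul (Matrix.of fun a b => W t (r a) (c b)) a (β (c a))
    fun i => W t (r i) (c a + 1)
  refine Eq.trans ?_ h1.symm
  rw [colMinor]
  congr 2
  ext x y
  by_cases hy : y = a
  · subst hy
    simp
  · simp [hy]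

theorem colMinor_eq_zero_of_eq {ι : Type*} {W : ι → ℕ → ℝ} {k : ℕ} {r : Fin k → ι}
    {c : Fin k → ℕ} {a b : Fin k} (hab : a ≠ b) (h : c a = c b) : colMinor W r c = 0 :=
  Matrix.det_zero_of_column_eq hab fun _ => by simp [h]

theorem colMinor_eq_zero_of_lt {n : ℕ} {W : Fin (n + 1) → ℕ → ℝ} (hW : ∀ i j, n < j → W i j = 0)
    {k : ℕ} {r : Fin k → Fin (n + 1)} {c : Fin k → ℕ} {b : Fin k} (h : n < c b) :
    colMinor W r c = 0 :=
  Matrix.det_eq_zero_of_column_eq_zero b fun _ => hW _ _ h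

theorem colMinor_id_self {n : ℕ} {W : Fin (n + 1) → ℕ → ℝ}
    (hW : ∀ i j, W i j = if (i : ℕ) = j then 1 else 0) {k : ℕ} {r : Fin k → Fin (n + 1)}
    (hr : StrictMono r) : colMinor W r (fun a => r a) = 1 := by
  rw [colMinor, ← Matrix.det_one (n := Fin k)]
  congr 1
  ext a b
  simp [hW, Matrix.one_apply, Fin.val_inj, hr.injective.eq_iff]

/-- The minor is 1 if the columns are exactly the rows; otherwise it has a repeated column or a zero
row. Monotonicity of `c` excludes the odd permutations, which would give -1. -/
theorem colMinor_id_nonneg {n : ℕ} {W : Fin (n + 1) → ℕ → ℝ}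
    (hW : ∀ i j, W i j = if (i : ℕ) = j then 1 else 0) {k : ℕ} {r : Fin k → Fin (n + 1)}
    (hr : StrictMono r) {c : Fin k → ℕ} (hc : Monotone c) : 0 ≤ colMinor W r c := by
  by_cases hinj : Function.Injective c
  · by_cases hsub : ∀ a, ∃ b, c b = r a
    · have hc' : StrictMono c := hc.strictMono_of_injective hinj
      have hr' : StrictMono fun a => (r a : ℕ) := fun a b h => hr h
      have himg : Finset.univ.image (fun a => (r a : ℕ)) = Finset.univ.image c := by
        refine Finset.eq_of_subset_of_card_le (fun x hx => ?_) ?_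
        · obtain ⟨a, -, rfl⟩ := Finset.mem_image.1 hx
          obtain ⟨b, hb⟩ := hsub a
          exact Finset.mem_image.2 ⟨b, Finset.mem_univ _, hb⟩
        · rw [Finset.card_image_of_injective _ hinj,
            Finset.card_image_of_injective _ hr'.injective]
      have : (fun a => (r a : ℕ)) = c := by
        refine (StrictMono.range_inj hr' hc').1 ?_
        simpa using congrArg (fun s : Finset ℕ => (s : Set ℕ)) himg
      rw [← this, colMinor_id_self hW hr]
      exact zero_le_one
    · push Not at hsub
      obtain ⟨a, ha⟩ := hsub
      refine (Matrix.det_eq_zero_of_row_eq_zero a fun b => ?_).ge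
      simp [hW, (ha b).symm]
  · simp only [Function.Injective, not_forall] at hinj
    obtain ⟨a, b, h, hab⟩ := hinj
    exact (colMinor_eq_zero_of_eq hab h).ge

theorem monotone_update_succ {k : ℕ} {c : Fin k → ℕ} (hc : StrictMono c) (a : Fin k) :
    Monotone (Function.update c a (c a + 1)) := by
  intro x y hxy
  rcases hxy.eq_or_lt with rfl | hlt
  · exact le_rfl
  have := hc hlt
  by_cases hx : x = a
  · subst hx
    rw [Function.update_self, Function.update_of_ne hlt.ne']
    exact this
  · rw [Function.update_of_ne hx]
    by_cases hy : y = a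
    · subst hy
      rw [Function.update_self]
      omega
    · rw [Function.update_of_ne hy]
      exact this.le

theorem sum_update_succ {k : ℕ} (c : Fin k → ℕ) (a : Fin k) :
    ∑ b, Function.update c a (c a + 1) b = ∑ b, c b + 1 := by
  rw [Finset.sum_update_of_mem (Finset.mem_univ a), ← Finset.add_sum_erase _ _ (Finset.mem_univ a),
    ← Finset.erase_eq]
  ring

theorem exists_update_succ_le {k : ℕ} {c r : Fin k → ℕ} (hc : StrictMono c) (hr : StrictMono r)
    (hle : ∀ a, c a ≤ r a) (hne : c ≠ r) :
    ∃ a, StrictMono (Function.update c a (c a + 1)) ∧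
      ∀ b, Function.update c a (c a + 1) b ≤ r b := by
  have hnon : (Finset.univ.filter fun a => c a < r a).Nonempty := by
    obtain ⟨a, ha⟩ := Function.ne_iff.1 hne
    exact ⟨a, by simpa using lt_of_le_of_ne (hle a) ha⟩
  -- Raising the last index with `c a < r a` causes no collision: beyond it `c y = r y > r a ≥ c a +
  -- 1`.
  obtain ⟨a, ha, hmax⟩ := Finset.exists_max_image _ id hnon
  simp only [Finset.mem_filter, Finset.mem_univ, true_and, id] at ha hmax
  refine ⟨a, ?_, fun b => ?_⟩
  · refine (monotone_update_succ hc a).strictMono_of_injective ?_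
    have key : ∀ y, y ≠ a → c y ≠ c a + 1 := by
      intro y hy heq
      have hay : a < y := hc.lt_iff_lt.1 (by omega)
      have h1 := hr hay
      have h2 := hle y
      have := hmax y (by omega)
      exact absurd hay (not_lt.2 this)
    intro x y hxy
    by_cases hx : x = a <;> by_cases hy : y = a
    · rw [hx, hy]
    · subst hx
      rw [Function.update_self, Function.update_of_ne hy] at hxy
      exact absurd hxy.symm (key y hy)
    · subst hy
      rw [Function.update_self, Function.update_of_ne hx] at hxy
      exact absurd hxy (key x hx)
    · rw [Function.update_of_ne hy, Function.update_of_ne hx] at hxy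
      exact hc.injective hxy
  · by_cases hb : b = a
    · subst hb
      rw [Function.update_self]
      exact ha
    · rw [Function.update_of_ne hb]
      exact hle b

section MinorPositivity

open MeasureTheory

variable {n : ℕ} {W : ℝ → Fin (n + 1) → ℕ → ℝ}

theorem absolutelyContinuousOnInterval_colMinor {a b : ℝ}
    (hac : ∀ i j, AbsolutelyContinuousOnInterval (fun t => W t i j) a b) {k : ℕ}
    (r : Fin k → Fin (n + 1)) (c : Fin k → ℕ) :
    AbsolutelyContinuousOnInterval (fun t => colMinor (W t) r c) a b :=
  AbsolutelyContinuousOnInterval.det fun _ _ => hac _ _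

theorem exists_lt_of_mul_le_sum {k : ℕ} (hk : 1 ≤ k) {c : Fin k → ℕ}
    (h : k * (n + 1) ≤ ∑ a, c a) : ∃ a, n < c a := by
  by_contra! hcon
  have := Finset.sum_le_sum fun a (_ : a ∈ Finset.univ) => hcon a
  simp only [Finset.sum_const, Finset.card_univ, Fintype.card_fin, smul_eq_mul] at this
  nlinarith

/-- The minor is nonnegative at time 0 and its derivative is a nonnegative combination of minors
nearer the right edge. Raising an index may create a repeated column, so `c` is only assumed
monotone. -/
theorem colMinor_nonneg_of_curve
    (hac : ∀ i j, AbsolutelyContinuousOnInterval (fun t => W t i j) 0 1)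
    (hder : ∀ᵐ t : ℝ, t ∈ Set.Ioo (0 : ℝ) 1 → ∃ β : ℕ → ℝ, (∀ j, 0 < β j) ∧
      ∀ i j, HasDerivAt (fun s => W s i j) (β j * W t i (j + 1)) t)
    (h0 : ∀ i j, W 0 i j = if (i : ℕ) = j then 1 else 0)
    (hW : ∀ t i j, n < j → W t i j = 0) {k : ℕ} (hk : 1 ≤ k) {r : Fin k → Fin (n + 1)}
    (hr : StrictMono r) {c : Fin k → ℕ} (hc : Monotone c) {t : ℝ} (ht : t ∈ Set.Icc (0 : ℝ) 1) :
    0 ≤ colMinor (W t) r c := by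
  -- Each raise adds 1 to `∑ a, c a`; once this reaches `k * (n + 1)`, some index exceeds `n` and
  -- its column is zero.
  obtain ⟨N, hN⟩ : ∃ N, k * (n + 1) ≤ ∑ a, c a + N := ⟨_, Nat.le_add_left _ _⟩
  induction N generalizing c t with
  | zero =>
    obtain ⟨a, ha⟩ := exists_lt_of_mul_le_sum hk hN
    exact (colMinor_eq_zero_of_lt (hW t) ha).ge
  | succ N ih =>
    by_cases hinj : Function.Injective c
    · have hc' : StrictMono c := hc.strictMono_of_injective hinj
      refine (colMinor_id_nonneg h0 hr hc).trans
        ((absolutelyContinuousOnInterval_colMinor hac r c).monotoneOn_of_ae_hasDerivAt_nonneg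
          zero_le_one (hder.mono fun s hs hsI => ?_) ⟨le_rfl, zero_le_one⟩ ht ht.1)
      obtain ⟨β, hβ, hd⟩ := hs hsI
      refine ⟨_, Finset.sum_nonneg fun a _ => mul_nonneg (hβ _).le ?_, hasDerivAt_colMinor hd r c⟩
      refine ih (monotone_update_succ hc' a) ⟨hsI.1.le, hsI.2.le⟩ ?_
      rw [sum_update_succ]
      omega
    · simp only [Function.Injective, not_forall] at hinj
      obtain ⟨a, b, h, hab⟩ := hinj
      exact (colMinor_eq_zero_of_eq hab h).ge

/-- If `c = r`, the minor starts at 1 and never decreases. Otherwise some raise keeps the columns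
distinct and below `r`; by induction its term makes the derivative positive almost everywhere. -/
theorem colMinor_pos_of_curve
    (hac : ∀ i j, AbsolutelyContinuousOnInterval (fun t => W t i j) 0 1)
    (hder : ∀ᵐ t : ℝ, t ∈ Set.Ioo (0 : ℝ) 1 → ∃ β : ℕ → ℝ, (∀ j, 0 < β j) ∧
      ∀ i j, HasDerivAt (fun s => W s i j) (β j * W t i (j + 1)) t)
    (h0 : ∀ i j, W 0 i j = if (i : ℕ) = j then 1 else 0)
    (hW : ∀ t i j, n < j → W t i j = 0) {k : ℕ} (hk : 1 ≤ k) {r : Fin k → Fin (n + 1)}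
    (hr : StrictMono r) {c : Fin k → ℕ} (hc : StrictMono c) (hcr : ∀ a, c a ≤ r a) {t : ℝ}
    (ht : t ∈ Set.Ioc (0 : ℝ) 1) : 0 < colMinor (W t) r c := by
  obtain ⟨N, hN⟩ : ∃ N, k * (n + 1) ≤ ∑ a, c a + N := ⟨_, Nat.le_add_left _ _⟩
  induction N generalizing c t with
  | zero =>
    obtain ⟨a, ha⟩ := exists_lt_of_mul_le_sum hk hN
    have := hcr a
    omega
  | succ N ih =>
    have hder' : ∀ s ∈ Set.Ioo (0 : ℝ) 1, ∀ β : ℕ → ℝ, (∀ j, 0 < β j) → ∀ a,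
        0 ≤ β (c a) * colMinor (W s) r (Function.update c a (c a + 1)) := fun s hs β hβ a =>
      mul_nonneg (hβ _).le (colMinor_nonneg_of_curve hac hder h0 hW hk hr
        (monotone_update_succ hc a) ⟨hs.1.le, hs.2.le⟩)
    by_cases heq : c = fun a => (r a : ℕ)
    · have h1 : colMinor (W 0) r c = 1 := by rw [heq, colMinor_id_self h0 hr]
      have := (absolutelyContinuousOnInterval_colMinor hac r c).monotoneOn_of_ae_hasDerivAt_nonneg
        zero_le_one (hder.mono fun s hs hsI => by
          obtain ⟨β, hβ, hd⟩ := hs hsI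
          exact ⟨_, Finset.sum_nonneg fun a _ => hder' s hsI β hβ a, hasDerivAt_colMinor hd r c⟩)
        ⟨le_rfl, zero_le_one⟩ ⟨ht.1.le, ht.2⟩ ht.1.le
      simp only [h1] at this
      linarith
    · obtain ⟨a, ha, hle⟩ := exists_update_succ_le hc (r := fun a => (r a : ℕ))
        (fun _ _ h => hr h) hcr heq
      refine (colMinor_id_nonneg h0 hr hc.monotone).trans_lt
        ((absolutelyContinuousOnInterval_colMinor hac r c).lt_of_ae_hasDerivAt_pos ht.1 ht.2
          (hder.mono fun s hs hsI => ?_))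
      obtain ⟨β, hβ, hd⟩ := hs hsI
      refine ⟨_, Finset.sum_pos' (fun b _ => hder' s hsI β hβ b) ⟨a, Finset.mem_univ _,
        mul_pos (hβ _) (ih ha hle ⟨hsI.1, hsI.2.le⟩ ?_)⟩, hasDerivAt_colMinor hd r c⟩
      rw [sum_update_succ]
      omega

end MinorPositivity

/-! ### Convex curves end at totally positive matrices -/

/-- Entry of a matrix, with the columns extended by zero beyond the last one. -/
def extendCol {n : ℕ} (A : Matrix (Fin (n + 1)) (Fin (n + 1)) ℝ) (i : Fin (n + 1)) (j : ℕ) : ℝ :=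
  if h : j < n + 1 then A i ⟨j, h⟩ else 0

theorem mul_sum_subdiagonalUnit {n : ℕ} (A : Matrix (Fin (n + 1)) (Fin (n + 1)) ℝ) (β : ℕ → ℝ)
    (i k : Fin (n + 1)) :
    (A * ∑ j : Fin n, β j • subdiagonalUnit j) i k = β k * extendCol A i (k + 1) := by
  have h1 : ∀ j : Fin n, (A * subdiagonalUnit j) i k =
      if j.castSucc = k then A i j.succ else 0 := by
    intro j
    rw [subdiagonalUnit]
    split_ifs with h
    · subst h
      simp
    · exact (Matrix.mul_single_apply_of_ne _ _ _ _ _ (Ne.symm h) _).trans rfl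
  simp only [Matrix.mul_sum, Matrix.mul_smul, Matrix.sum_apply, Matrix.smul_apply, h1, smul_eq_mul,
    mul_ite, mul_zero]
  by_cases hk : (k : ℕ) + 1 < n + 1
  · rw [Finset.sum_eq_single ⟨k, by omega⟩]
    · have hk' : (⟨k, by omega⟩ : Fin n).castSucc = k := rfl
      simp only [hk', if_true, extendCol, dif_pos hk]
      rfl
    · intro j _ hj
      rw [if_neg]
      rintro rfl
      exact hj (Fin.ext rfl)
    · simp
  · rw [extendCol, dif_neg hk, mul_zero]
    refine Finset.sum_eq_zero fun j _ => if_neg ?_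
    rintro rfl
    have := j.2
    simp at hk

theorem isUnit_det_of_mem_unipotentLower {n : ℕ} {L : Matrix (Fin (n + 1)) (Fin (n + 1)) ℝ}
    (hL : L ∈ unipotentLower n) : IsUnit L.det := by
  rw [det_of_mem_unipotentLower hL]
  exact isUnit_one

theorem mul_mem_unipotentLower {n : ℕ} {A B : Matrix (Fin (n + 1)) (Fin (n + 1)) ℝ}
    (hA : A ∈ unipotentLower n) (hB : B ∈ unipotentLower n) : A * B ∈ unipotentLower n := by
  have key : ∀ i j l, i ≤ j → l ≠ i ∨ i < j → A i l * B l j = 0 := by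
    intro i j l hij h
    rcases lt_trichotomy i l with hl | rfl | hl
    · rw [hA.1 _ _ hl, zero_mul]
    · rw [hB.1 _ _ (by simpa using h), mul_zero]
    · rw [hB.1 _ _ (hl.trans_le hij), mul_zero]
  refine ⟨fun i j h => ?_, fun i => ?_⟩
  · rw [Matrix.mul_apply]
    exact Finset.sum_eq_zero fun l _ => key i j l h.le (Or.inr h)
  · rw [Matrix.mul_apply, Finset.sum_eq_single i (fun l _ hl => key i i l le_rfl (Or.inl hl))
      (by simp), hA.2, hB.2, one_mul]

theorem inv_mem_unipotentLower {n : ℕ} {L : Matrix (Fin (n + 1)) (Fin (n + 1)) ℝ}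
    (hL : L ∈ unipotentLower n) : L⁻¹ ∈ unipotentLower n := by
  have hdet := isUnit_det_of_mem_unipotentLower hL
  have : Invertible L := Matrix.invertibleOfIsUnitDet L hdet
  have htri : ∀ i j, i < j → L⁻¹ i j = 0 := fun i j h =>
    Matrix.blockTriangular_inv_of_blockTriangular (M := L) (b := OrderDual.toDual)
      (fun _ _ h => hL.1 _ _ h) h
  refine ⟨htri, fun i => ?_⟩
  have h1 : (L * L⁻¹) i i = 1 := by rw [Matrix.mul_nonsing_inv _ hdet, Matrix.one_apply_eq]
  rw [Matrix.mul_apply, Finset.sum_eq_single i, hL.2, one_mul] at h1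
  · exact h1
  · intro l _ hl
    rcases hl.lt_or_gt with h | h
    · rw [htri _ _ h, mul_zero]
    · rw [hL.1 _ _ h, zero_mul]
  · simp

open MeasureTheory in
theorem IsConvexCurve.isTotallyPositive {n : ℕ} {Γ : ℝ → Matrix (Fin (n + 1)) (Fin (n + 1)) ℝ}
    (hΓ : IsConvexCurve Γ 0 1) : IsTotallyPositive ((Γ 0)⁻¹ * Γ 1) := by
  obtain ⟨hmem, hac, hder⟩ := hΓ
  have hm0 := hmem 0 ⟨le_rfl, zero_le_one⟩
  have hm1 := hmem 1 ⟨zero_le_one, le_rfl⟩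
  refine ⟨mul_mem_unipotentLower (inv_mem_unipotentLower hm0) hm1, fun k hk r c hcr => ?_⟩
  set W : ℝ → Fin (n + 1) → ℕ → ℝ := fun t => extendCol ((Γ 0)⁻¹ * Γ t) with hWdef
  have hWac : ∀ i j, AbsolutelyContinuousOnInterval (fun t => W t i j) 0 1 := by
    intro i j
    by_cases hj : j < n + 1
    · simp only [hWdef, extendCol, dif_pos hj, Matrix.mul_apply]
      exact AbsolutelyContinuousOnInterval.fun_finset_sum _ fun l _ => (hac l _).const_mul _
    · simp only [hWdef, extendCol, dif_neg hj]
      exact AbsolutelyContinuousOnInterval.const 0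
  have hWder : ∀ᵐ t : ℝ, t ∈ Set.Ioo (0 : ℝ) 1 → ∃ β : ℕ → ℝ, (∀ j, 0 < β j) ∧
      ∀ i j, HasDerivAt (fun s => W s i j) (β j * W t i (j + 1)) t := by
    have hae : ∀ᵐ t : ℝ, ∀ i k, t ∈ Set.uIcc (0 : ℝ) 1 →
        DifferentiableAt ℝ (fun s => Γ s i k) t := by
      rw [ae_all_iff]
      intro i
      rw [ae_all_iff]
      exact fun k => (hac i k).ae_differentiableAt
    filter_upwards [hae] with t ht htI
    have htI' : t ∈ Set.Icc (0 : ℝ) 1 := ⟨htI.1.le, htI.2.le⟩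
    have hD : ∀ i k, HasDerivAt (fun s => Γ s i k) (deriv (fun s => Γ s i k) t) t := fun i k =>
      (ht i k (by rwa [Set.uIcc_of_le zero_le_one])).hasDerivAt
    set D : Matrix (Fin (n + 1)) (Fin (n + 1)) ℝ := Matrix.of fun i k => deriv (fun s => Γ s i k) t
      with hDdef
    obtain ⟨β, hβ, hβD⟩ := hder t htI' D fun i k => (hD i k).hasDerivWithinAt
    -- The default 1 only keeps `β'` positive: for `j ≥ n` it multiplies a column that is zero.
    set β' : ℕ → ℝ := fun j => if h : j < n then β ⟨j, h⟩ else 1 with hβ'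
    have hββ' : ∑ j, β j • subdiagonalUnit j = ∑ j : Fin n, β' j • subdiagonalUnit j :=
      Finset.sum_congr rfl fun j _ => by simp [hβ']
    have hDeq : (Γ 0)⁻¹ * D = ((Γ 0)⁻¹ * Γ t) * ∑ j : Fin n, β' j • subdiagonalUnit j := by
      rw [← hββ', ← hβD, Matrix.mul_assoc, Matrix.mul_nonsing_inv_cancel_left _ _
        (isUnit_det_of_mem_unipotentLower (hmem t htI'))]
    refine ⟨β', fun j => ?_, fun i j => ?_⟩
    · simp only [hβ']
      split_ifs
      · exact hβ _
      · exact one_pos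
    · by_cases hj : j < n + 1
      · have h1 := mul_sum_subdiagonalUnit ((Γ 0)⁻¹ * Γ t) β' i ⟨j, hj⟩
        rw [← hDeq] at h1
        rw [hWdef, ← h1]
        simp only [extendCol, dif_pos hj, Matrix.mul_apply]
        exact HasDerivAt.fun_sum fun l _ => (hD l _).const_mul _
      · have hj' : ¬ j + 1 < n + 1 := by omega
        simp only [hWdef, extendCol, dif_neg hj, dif_neg hj', mul_zero]
        exact hasDerivAt_const t 0
  have hW0 : ∀ i j, W 0 i j = if (i : ℕ) = j then 1 else 0 := by
    intro i j
    simp only [hWdef, extendCol, Matrix.nonsing_inv_mul _ (isUnit_det_of_mem_unipotentLower hm0),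
      Matrix.one_apply, Fin.ext_iff]
    have := i.2
    split_ifs <;> first | rfl | omega
  have hWz : ∀ t i j, n < j → W t i j = 0 := fun t i j h => dif_neg (by omega)
  have := colMinor_pos_of_curve hWac hWder hW0 hWz hk r.strictMono (c := fun a => (c a : ℕ))
    (fun _ _ h => c.strictMono h) (fun a => hcr a) (t := 1) ⟨one_pos, le_rfl⟩
  convert! this using 1
  rw [colMinor]
  congr 1
  ext a b
  simp only [hWdef, extendCol, Matrix.submatrix_apply, Matrix.of_apply, dif_pos (c b).2]

/-! ### Factorization by clearing rows from the bottom -/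

/-- An infinite unipotent lower triangular array which is trivial below row `s` and whose minors
with rows `r, …, s` and columns `c, c + 1, …` with `c ≤ r` are positive. -/
structure IsFlagPositive (s : ℕ) (M : ℕ → ℕ → ℝ) : Prop where
  lower : ∀ i j, i < j → M i j = 0
  diag : ∀ i, M i i = 1
  trivial_below : ∀ i j, s < i → M i j = if i = j then 1 else 0
  minor_pos : ∀ k r c : ℕ, r + k = s + 1 → c ≤ r →
    0 < (Matrix.of fun a b : Fin k => M (r + a) (c + b)).det

theorem IsFlagPositive.last_row_pos {s : ℕ} {M : ℕ → ℕ → ℝ} (h : IsFlagPositive s M) {j : ℕ}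
    (hj : j ≤ s) : 0 < M s j := by
  simpa [Matrix.det_unique] using h.minor_pos 1 s j rfl hj

/-- The column operations that clear the last nontrivial row of an array. -/
noncomputable def peel (s : ℕ) (M : ℕ → ℕ → ℝ) (i j : ℕ) : ℝ :=
  if j ≤ s then M i j - M (s + 1) j / M (s + 1) (j + 1) * M i (j + 1) else M i j

theorem eq_peel_add {s : ℕ} {M : ℕ → ℕ → ℝ} {i j : ℕ} (hj : j ≤ s) :
    M i j = peel s M i j + M (s + 1) j / M (s + 1) (j + 1) * M i (j + 1) := by
  rw [peel, if_pos hj]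
  ring

theorem IsFlagPositive.peel_last_row {s : ℕ} {M : ℕ → ℕ → ℝ} (h : IsFlagPositive (s + 1) M)
    {j : ℕ} (hj : j ≤ s) : peel s M (s + 1) j = 0 := by
  rw [peel, if_pos hj, div_mul_cancel₀ _ (h.last_row_pos (by omega)).ne', sub_self]

/-- Add row `s + 1` and column `c + k` to the peeled minor. Column operations turn the enlarged
minor of `M` into one whose last row is zero except for its corner `M (s + 1) (c + k)`; expand along
that row. -/
theorem IsFlagPositive.det_peel_mul {s : ℕ} {M : ℕ → ℕ → ℝ} (h : IsFlagPositive (s + 1) M)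
    {k r c : ℕ} (hrk : r + k = s + 1) (hcr : c ≤ r) :
    (Matrix.of fun a b : Fin k => peel s M (r + a) (c + b)).det * M (s + 1) (c + k) =
      (Matrix.of fun a b : Fin (k + 1) => M (r + a) (c + b)).det := by
  set A : Matrix (Fin (k + 1)) (Fin (k + 1)) ℝ := Matrix.of fun a b => M (r + a) (c + b) with hA
  set B : Matrix (Fin (k + 1)) (Fin (k + 1)) ℝ := Matrix.of fun a b =>
    if (b : ℕ) < k then peel s M (r + a) (c + b) else M (r + a) (c + b) with hB
  -- Peeling uses the next column, whereas the determinant lemma uses the previous one; hence the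
  -- reversal of the indices.
  have hAB : A.det = B.det := by
    rw [← Matrix.det_submatrix_equiv_self Fin.revPerm A,
      ← Matrix.det_submatrix_equiv_self Fin.revPerm B]
    refine Matrix.det_eq_of_forall_col_eq_smul_add_pred
      (fun j => M (s + 1) (c + j.rev) / M (s + 1) (c + j.rev + 1)) (fun i => ?_) fun i j => ?_
    · simp [hA, hB]
    · have hj : (j.rev : ℕ) < k := j.rev.2
      simp only [hA, hB, Matrix.submatrix_apply, Fin.revPerm_apply, Matrix.of_apply, Fin.rev_succ,
        Fin.rev_castSucc, Fin.val_castSucc, Fin.val_succ, if_pos hj]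
      exact eq_peel_add (by omega)
  rw [hAB, Matrix.det_succ_row B (Fin.last k), Finset.sum_eq_single (Fin.last k)]
  · have h1 : B (Fin.last k) (Fin.last k) = M (s + 1) (c + k) := by simp [hB, hrk]
    have h2 : B.submatrix (Fin.last k).succAbove (Fin.last k).succAbove =
        Matrix.of fun a b : Fin k => peel s M (r + a) (c + b) := by
      ext a b
      simp [hB, Fin.succAbove_last]
    rw [h1, h2, Even.neg_one_pow ⟨_, rfl⟩]
    ring
  · intro b _ hb
    have hbk : (b : ℕ) < k := Fin.val_lt_last hb
    have h1 : B (Fin.last k) b = 0 := by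
      simp only [hB, Matrix.of_apply, if_pos hbk, Fin.val_last, hrk]
      exact h.peel_last_row (by omega)
    rw [h1, mul_zero, zero_mul]
  · simp

/-- Minors on bottom rows and consecutive columns form a family closed under peeling: by
`det_peel_mul` each new one is a quotient of an old one by a positive entry. -/
theorem IsFlagPositive.peel {s : ℕ} {M : ℕ → ℕ → ℝ} (h : IsFlagPositive (s + 1) M) :
    IsFlagPositive s (peel s M) where
  lower i j hij := by
    rw [_root_.peel, h.lower i j hij, h.lower i (j + 1) (by omega)]
    simp
  diag i := by
    rw [_root_.peel, h.diag i, h.lower i (i + 1) (by omega)]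
    simp
  trivial_below i j hi := by
    by_cases hj : j ≤ s
    · rw [if_neg (by omega)]
      rcases (Nat.succ_le_of_lt hi).eq_or_lt with rfl | hi'
      · exact h.peel_last_row hj
      · rw [_root_.peel, if_pos hj, h.trivial_below i j hi', h.trivial_below i (j + 1) hi',
          if_neg (by omega), if_neg (by omega)]
        simp
    · rw [_root_.peel, if_neg hj]
      rcases lt_trichotomy i j with hij | rfl | hij
      · rw [h.lower _ _ hij, if_neg hij.ne]
      · rw [h.diag, if_pos rfl]
      · rw [h.trivial_below i j (by omega)]
  minor_pos k r c hrk hcr := by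
    have h1 := h.minor_pos (k + 1) r c (by omega) hcr
    rw [← h.det_peel_mul hrk hcr] at h1
    exact pos_of_mul_pos_left h1 (h.last_row_pos (by omega)).le

theorem IsFlagPositive.exists_factorization {s : ℕ} {M : ℕ → ℕ → ℝ} (h : IsFlagPositive s M) :
    ∃ (N : ℕ → ℕ → ℕ → ℝ) (τ : ℕ → ℕ → ℝ), N s = M ∧ (∀ σ ≤ s, IsFlagPositive σ (N σ)) ∧
      (∀ σ < s, ∀ j ≤ σ, 0 < τ (σ + 1) j) ∧
      ∀ σ < s, ∀ i, ∀ j ≤ σ, N (σ + 1) i j = N σ i j + τ (σ + 1) j * N (σ + 1) i (j + 1) := by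
  induction s generalizing M with
  | zero =>
    refine ⟨fun _ => M, fun _ _ => 0, rfl, fun σ hσ => ?_, by simp, by simp⟩
    obtain rfl : σ = 0 := by omega
    exact h
  | succ s ih =>
    obtain ⟨N, τ, hN, hpos, hτ, hrec⟩ := ih h.peel
    refine ⟨Function.update N (s + 1) M,
      Function.update τ (s + 1) fun j => M (s + 1) j / M (s + 1) (j + 1),
      Function.update_self _ _ _, fun σ hσ => ?_, fun σ hσ j hj => ?_, fun σ hσ i j hj => ?_⟩
    · rcases hσ.eq_or_lt with rfl | hσ'
      · rwa [Function.update_self]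
      · rw [Function.update_of_ne hσ'.ne]
        exact hpos σ (by omega)
    · rcases (Nat.le_of_lt_succ hσ).eq_or_lt with rfl | hσ'
      · rw [Function.update_self]
        exact div_pos (h.last_row_pos (by omega)) (h.last_row_pos (by omega))
      · rw [Function.update_of_ne (by omega)]
        exact hτ σ hσ' j hj
    · rcases (Nat.le_of_lt_succ hσ).eq_or_lt with rfl | hσ'
      · rw [Function.update_self, Function.update_self, Function.update_of_ne (by omega), hN]
        exact eq_peel_add hj
      · rw [Function.update_of_ne (by omega), Function.update_of_ne (by omega),
          Function.update_of_ne (by omega)]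
        exact hrec σ hσ' i j hj

/-- The infinite array extending a finite square matrix by the identity. -/
def extendArray {n : ℕ} (L : Matrix (Fin (n + 1)) (Fin (n + 1)) ℝ) (i j : ℕ) : ℝ :=
  if h : i < n + 1 ∧ j < n + 1 then L ⟨i, h.1⟩ ⟨j, h.2⟩ else if i = j then 1 else 0

theorem IsTotallyPositive.isFlagPositive {n : ℕ} {L : Matrix (Fin (n + 1)) (Fin (n + 1)) ℝ}
    (hL : IsTotallyPositive L) : IsFlagPositive n (extendArray L) where
  lower i j hij := by
    rw [extendArray]
    split_ifs with h
    · exact hL.1.1 _ _ hij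
    · omega
    · rfl
  diag i := by
    by_cases h : i < n + 1
    · rw [extendArray, dif_pos ⟨h, h⟩]
      exact hL.1.2 _
    · rw [extendArray, dif_neg (by omega), if_pos rfl]
  trivial_below i j hi := by
    rw [extendArray, dif_neg (by omega)]
  minor_pos k r c hrk hcr := by
    rcases Nat.eq_zero_or_pos k with rfl | hk
    · simp
    have hlt : ∀ a : Fin k, r + a < n + 1 := fun a => by omega
    have hlt' : ∀ a : Fin k, c + a < n + 1 := fun a => by omega
    have := hL.2 k hk
      (OrderEmbedding.ofStrictMono (fun a => ⟨r + a, hlt a⟩) fun a b h =>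
        Nat.add_lt_add_left h _)
      (OrderEmbedding.ofStrictMono (fun a => ⟨c + a, hlt' a⟩) fun a b h =>
        Nat.add_lt_add_left h _)
      fun a => Nat.add_le_add_right hcr _
    convert! this using 2
    ext a b
    exact dif_pos ⟨hlt a, hlt' b⟩

/-! ### Solving the linear equation by iterated integrals -/

/-- The iterated integral of `β j, β (j + 1), …, β (j + d - 1)`. -/
noncomputable def iterInt (β : ℕ → ℝ → ℝ) : ℕ → ℕ → ℝ → ℝ
  | 0, _, _ => 1
  | d + 1, j, t => ∫ u in (0 : ℝ)..t, β j u * iterInt β d (j + 1) u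

theorem iterInt_congr {β β' : ℕ → ℝ → ℝ} {j : ℕ} (h : ∀ l, j ≤ l → β l = β' l) (d : ℕ) :
    iterInt β d j = iterInt β' d j := by
  induction d generalizing j with
  | zero => rfl
  | succ d ih =>
    ext t
    rw [iterInt, iterInt, h j le_rfl, ih fun l hl => h l (by omega)]

theorem continuous_iterInt {X : Type*} [TopologicalSpace X] [FirstCountableTopology X]
    {B : X → ℕ → ℝ → ℝ} (hB : ∀ j, Continuous fun q : X × ℝ => B q.1 j q.2) (d j : ℕ) :
    Continuous fun q : X × ℝ => iterInt (B q.1) d j q.2 := by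
  induction d generalizing j with
  | zero => exact continuous_const
  | succ d ih =>
    simp only [iterInt]
    exact intervalIntegral.continuous_parametric_primitive_of_continuous
      (f := fun x u => B x j u * iterInt (B x) d (j + 1) u) ((hB j).mul (ih (j + 1)))

/-- The entries of the solution `Γ` of `Γ' = Γ (∑ j, β j • subdiagonalUnit j)`, `Γ 0 = 1`. -/
noncomputable def curveEntry (β : ℕ → ℝ → ℝ) (i j : ℕ) (t : ℝ) : ℝ :=
  if j ≤ i then iterInt β (i - j) j t else 0

/-- Column `j` sees only the controls of index at least `j`; this lets the weights be found column
by column, from right to left. -/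
theorem curveEntry_congr {β β' : ℕ → ℝ → ℝ} {j : ℕ} (h : ∀ l, j ≤ l → β l = β' l) (i : ℕ) :
    curveEntry β i j = curveEntry β' i j := by
  ext t
  rw [curveEntry, curveEntry, iterInt_congr h]

theorem curveEntry_of_lt {β : ℕ → ℝ → ℝ} {i j : ℕ} (h : i < j) (t : ℝ) :
    curveEntry β i j t = 0 :=
  if_neg (by omega)

theorem curveEntry_self (β : ℕ → ℝ → ℝ) (i : ℕ) (t : ℝ) : curveEntry β i i t = 1 := by
  rw [curveEntry, if_pos le_rfl, Nat.sub_self, iterInt]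

theorem continuous_curveEntry_param {X : Type*} [TopologicalSpace X] [FirstCountableTopology X]
    {B : X → ℕ → ℝ → ℝ} (hB : ∀ j, Continuous fun q : X × ℝ => B q.1 j q.2) (i j : ℕ) :
    Continuous fun q : X × ℝ => curveEntry (B q.1) i j q.2 := by
  unfold curveEntry
  split_ifs
  · exact continuous_iterInt hB _ _
  · exact continuous_const

theorem continuous_curveEntry {β : ℕ → ℝ → ℝ} (hβ : ∀ j, Continuous (β j)) (i j : ℕ) :
    Continuous (curveEntry β i j) :=
  (continuous_curveEntry_param (X := Unit) (B := fun _ => β)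
    (fun j => (hβ j).comp continuous_snd) i j).comp (Continuous.prodMk_right ())

theorem curveEntry_eq_integral (β : ℕ → ℝ → ℝ) (i j : ℕ) (t : ℝ) :
    curveEntry β i j t = (if i = j then 1 else 0) +
      ∫ u in (0 : ℝ)..t, β j u * curveEntry β i (j + 1) u := by
  rcases lt_trichotomy i j with h | rfl | h
  · rw [if_neg h.ne, curveEntry_of_lt h]
    simp [curveEntry_of_lt (show i < j + 1 by omega)]
  · rw [if_pos rfl, curveEntry_self]
    simp [curveEntry_of_lt (Nat.lt_succ_self i)]
  · obtain ⟨d, rfl⟩ : ∃ d, i = j + (d + 1) := ⟨i - j - 1, by omega⟩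
    rw [if_neg (by omega), zero_add, curveEntry, if_pos (by omega), Nat.add_sub_cancel_left,
      iterInt]
    refine intervalIntegral.integral_congr fun u _ => ?_
    have : j + (d + 1) - (j + 1) = d := by omega
    simp only [curveEntry, if_pos (show j + 1 ≤ j + (d + 1) by omega), this]

theorem hasDerivAt_curveEntry {β : ℕ → ℝ → ℝ} (hβ : ∀ j, Continuous (β j)) (i j : ℕ) (t : ℝ) :
    HasDerivAt (curveEntry β i j) (β j t * curveEntry β i (j + 1) t) t := by
  have h : curveEntry β i j = fun t => (if i = j then 1 else 0) +
      ∫ u in (0 : ℝ)..t, β j u * curveEntry β i (j + 1) u :=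
    funext fun t => curveEntry_eq_integral β i j t
  rw [h]
  exact (((hβ j).mul (continuous_curveEntry hβ i (j + 1))).integral_hasStrictDerivAt 0
    t).hasDerivAt.const_add _

/-! ### Bumps, time slots and controls -/

/-- A continuous nonnegative function supported in `[0, 1]` with integral 1. -/
noncomputable def bump (x : ℝ) : ℝ := 6 * max 0 (x * (1 - x))

theorem continuous_bump : Continuous bump := by
  unfold bump
  fun_prop

theorem bump_nonneg (x : ℝ) : 0 ≤ bump x := mul_nonneg (by norm_num) (le_max_left _ _)

theorem bump_of_nonpos {x : ℝ} (h : x ≤ 0) : bump x = 0 := by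
  rw [bump, max_eq_left (by nlinarith), mul_zero]

theorem bump_of_one_le {x : ℝ} (h : 1 ≤ x) : bump x = 0 := by
  rw [bump, max_eq_left (by nlinarith), mul_zero]

theorem integral_bump : ∫ x in (0 : ℝ)..1, bump x = 1 := by
  have h : ∫ x in (0 : ℝ)..1, bump x = ∫ x in (0 : ℝ)..1, (6 * x - 6 * x ^ 2) := by
    refine intervalIntegral.integral_congr fun x hx => ?_
    rw [Set.uIcc_of_le zero_le_one] at hx
    simp only [bump]
    rw [max_eq_right (mul_nonneg hx.1 (by linarith [hx.2]))]
    ring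
  rw [h, intervalIntegral.integral_sub (Continuous.intervalIntegrable (by fun_prop) _ _)
      (Continuous.intervalIntegrable (by fun_prop) _ _),
    intervalIntegral.integral_const_mul, intervalIntegral.integral_const_mul, integral_id,
    integral_pow]
  norm_num

theorem integral_bump_of_nonpos {b c : ℝ} (hb : b ≤ 0) (hc : c ≤ 0) :
    ∫ x in b..c, bump x = 0 := by
  rw [intervalIntegral.integral_congr (g := fun _ => 0), intervalIntegral.integral_zero]
  exact fun x hx => bump_of_nonpos (hx.2.trans (max_le hb hc))

theorem integral_bump_of_one_le {b c : ℝ} (hb : 1 ≤ b) (hc : 1 ≤ c) :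
    ∫ x in b..c, bump x = 0 := by
  rw [intervalIntegral.integral_congr (g := fun _ => 0), intervalIntegral.integral_zero]
  exact fun x hx => bump_of_one_le ((le_min hb hc).trans hx.1)

theorem integral_bump_of_le {b c : ℝ} (hb : b ≤ 0) (hc : 1 ≤ c) :
    ∫ x in b..c, bump x = 1 := by
  have hi : ∀ x y, IntervalIntegrable bump MeasureTheory.volume x y :=
    fun x y => continuous_bump.intervalIntegrable x y
  rw [← intervalIntegral.integral_add_adjacent_intervals (hi b 0) (hi 0 c),
    ← intervalIntegral.integral_add_adjacent_intervals (hi 0 1) (hi 1 c),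
    integral_bump_of_nonpos hb le_rfl, integral_bump, integral_bump_of_one_le le_rfl hc]
  norm_num

/-- The bump active in the time slot reserved for the letter `j` of the stage `σ`. Within a stage
the letters come in decreasing order. -/
noncomputable def slotBump (n σ j : ℕ) (t : ℝ) : ℝ := bump (t - (σ * (n + 1) - j))

theorem continuous_slotBump (n σ j : ℕ) : Continuous (slotBump n σ j) :=
  continuous_bump.comp (continuous_id.sub continuous_const)

theorem integral_slotBump (n σ j : ℕ) (t : ℝ) :
    ∫ u in (0 : ℝ)..t, slotBump n σ j u =
      ∫ u in (0 - (σ * (n + 1) - j) : ℝ)..t - (σ * (n + 1) - j), bump u :=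
  intervalIntegral.integral_comp_sub_right bump _

theorem slot_nonneg {n σ j : ℕ} (hj : j ≤ σ) : (0 : ℝ) ≤ σ * (n + 1) - j := by
  have h1 : (j : ℝ) ≤ σ := by exact_mod_cast hj
  have h2 : (0 : ℝ) ≤ σ * n := by positivity
  linarith

theorem integral_slotBump_eq_one {n σ j : ℕ} (hj : j ≤ σ) {t : ℝ}
    (ht : (σ * (n + 1) - j + 1 : ℝ) ≤ t) : ∫ u in (0 : ℝ)..t, slotBump n σ j u = 1 := by
  rw [integral_slotBump]
  exact integral_bump_of_le (by linarith [slot_nonneg (n := n) hj]) (by linarith)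

theorem integral_slotBump_eq_zero {n σ j : ℕ} (hj : j ≤ σ) {t : ℝ}
    (ht : t ≤ (σ * (n + 1) - j : ℝ)) : ∫ u in (0 : ℝ)..t, slotBump n σ j u = 0 := by
  rw [integral_slotBump]
  exact integral_bump_of_nonpos (by linarith [slot_nonneg (n := n) hj]) (by linarith)

/-- Every slot is over by time `(n + 1) ^ 2`, the final time of the curve. -/
theorem slot_add_one_le {n σ j : ℕ} (hσ : σ ≤ n) :
    (σ * (n + 1) - j + 1 : ℝ) ≤ (n + 1) ^ 2 := by
  have h1 : (σ : ℝ) ≤ n := by exact_mod_cast hσ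
  have h2 : (0 : ℝ) ≤ j := by positivity
  nlinarith

/-- The control with weights `p.1 σ j` on the slots, plus the constant `p.2`. -/
noncomputable def slotControl (n : ℕ) (p : (ℕ → ℕ → ℝ) × ℝ) (j : ℕ) (t : ℝ) : ℝ :=
  p.2 + ∑ σ ∈ Finset.Ioc j n, p.1 σ j * slotBump n σ j t

theorem continuous_slotControl (n j : ℕ) :
    Continuous fun q : ((ℕ → ℕ → ℝ) × ℝ) × ℝ => slotControl n q.1 j q.2 := by
  unfold slotControl
  refine (continuous_snd.comp continuous_fst).add (continuous_finsetSum _ fun σ _ => ?_)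
  refine Continuous.mul ?_ ((continuous_slotBump n σ j).comp continuous_snd)
  fun_prop

theorem continuous_slotControl_right (n : ℕ) (p : (ℕ → ℕ → ℝ) × ℝ) (j : ℕ) :
    Continuous (slotControl n p j) :=
  (continuous_slotControl n j).comp (Continuous.prodMk_right p)

theorem integral_slotControl_mul {n : ℕ} (p : (ℕ → ℕ → ℝ) × ℝ) (j : ℕ) {f : ℝ → ℝ}
    (hf : Continuous f) (t : ℝ) :
    ∫ u in (0 : ℝ)..t, slotControl n p j u * f u = p.2 * (∫ u in (0 : ℝ)..t, f u) +
      ∑ σ ∈ Finset.Ioc j n, p.1 σ j * ∫ u in (0 : ℝ)..t, slotBump n σ j u * f u := by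
  have hi : ∀ σ ∈ Finset.Ioc j n, IntervalIntegrable
      (fun u => p.1 σ j * (slotBump n σ j u * f u)) MeasureTheory.volume 0 t := fun σ _ =>
    (continuous_const.mul ((continuous_slotBump n σ j).mul hf)).intervalIntegrable 0 t
  simp only [slotControl, add_mul, Finset.sum_mul, mul_assoc]
  have hi' : IntervalIntegrable (fun u => p.2 * f u) MeasureTheory.volume 0 t :=
    (continuous_const.mul hf).intervalIntegrable 0 t
  have hsum : IntervalIntegrable
      (fun u => ∑ σ ∈ Finset.Ioc j n, p.1 σ j * (slotBump n σ j u * f u))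
      MeasureTheory.volume 0 t :=
    (continuous_finsetSum _ fun σ _ => continuous_const.mul
      ((continuous_slotBump n σ j).mul hf)).intervalIntegrable 0 t
  rw [intervalIntegral.integral_add hi' hsum, intervalIntegral.integral_finsetSum hi]
  simp only [intervalIntegral.integral_const_mul]

/-! ### The degenerate curve, one letter at a time -/

section Degenerate

variable {n : ℕ} {N : ℕ → ℕ → ℕ → ℝ} {τ : ℕ → ℕ → ℝ}

/-- Telescope the recursion from stage `j`, where column `j` is still that of the identity. -/
theorem factorization_eq_sum (hN : ∀ σ ≤ n, IsFlagPositive σ (N σ))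
    (hrec : ∀ σ < n, ∀ i, ∀ j ≤ σ, N (σ + 1) i j = N σ i j + τ (σ + 1) j * N (σ + 1) i (j + 1))
    {j σ : ℕ} (hj : j ≤ σ) (hσ : σ ≤ n) (i : ℕ) :
    N σ i j = (if i = j then 1 else 0) + ∑ ρ ∈ Finset.Ioc j σ, τ ρ j * N ρ i (j + 1) := by
  induction σ, hj using Nat.le_induction with
  | base =>
    rw [Finset.Ioc_self, Finset.sum_empty, add_zero]
    rcases lt_trichotomy i j with h | rfl | h
    · rw [if_neg h.ne, (hN j hσ).lower i j h]
    · rw [if_pos rfl, (hN i hσ).diag]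
    · rw [(hN j hσ).trivial_below i j h]
  | succ σ hj ih =>
    rw [Finset.sum_Ioc_succ_top (by omega), hrec σ (by omega) i j hj, ih (by omega), add_assoc]

/-- During the slot of letter `j` in stage `σ`, column `j + 1` is frozen at its stage `σ` value: its
slots up to stage `σ` are over, the last ending exactly when this one starts, and its later slots
have not begun. -/
theorem slotBump_mul_curveEntry_of_eq (hN : ∀ σ ≤ n, IsFlagPositive σ (N σ))
    (hrec : ∀ σ < n, ∀ i, ∀ j ≤ σ, N (σ + 1) i j = N σ i j + τ (σ + 1) j * N (σ + 1) i (j + 1))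
    {i j : ℕ} (h : ∀ t, curveEntry (slotControl n (τ, 0)) i (j + 1) t = (if i = j + 1 then 1 else 0) +
      ∑ ρ ∈ Finset.Ioc (j + 1) n,
        τ ρ (j + 1) * (∫ u in (0 : ℝ)..t, slotBump n ρ (j + 1) u) * N ρ i (j + 1 + 1))
    {σ : ℕ} (hσ : σ ∈ Finset.Ioc j n) (u : ℝ) :
    slotBump n σ j u * curveEntry (slotControl n (τ, 0)) i (j + 1) u =
      slotBump n σ j u * N σ i (j + 1) := by
  rw [Finset.mem_Ioc] at hσ
  by_cases hu : u ≤ σ * (n + 1) - j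
  · rw [slotBump, bump_of_nonpos (by linarith), zero_mul, zero_mul]
  by_cases hu' : (σ * (n + 1) - j + 1 : ℝ) ≤ u
  · rw [slotBump, bump_of_one_le (by linarith), zero_mul, zero_mul]
  push Not at hu hu'
  congr 1
  rw [h, factorization_eq_sum hN hrec (Nat.succ_le_of_lt hσ.1) hσ.2]
  congr 1
  rw [← Finset.sum_subset (Finset.Ioc_subset_Ioc_right hσ.2)]
  · refine Finset.sum_congr rfl fun ρ hρ => ?_
    rw [Finset.mem_Ioc] at hρ
    rw [integral_slotBump_eq_one hρ.1.le, mul_one]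
    have : (ρ : ℝ) ≤ σ := by exact_mod_cast hρ.2
    push_cast
    nlinarith
  · intro ρ hρ hρσ
    simp only [Finset.mem_Ioc] at hρ hρσ
    have h1 : σ + 1 ≤ ρ := by omega
    rw [integral_slotBump_eq_zero hρ.1.le, mul_zero, zero_mul]
    have h1' : (σ + 1 : ℝ) ≤ ρ := by exact_mod_cast h1
    have h2 : (1 : ℝ) ≤ n := by exact_mod_cast (by omega : 1 ≤ n)
    push_cast
    nlinarith

theorem curveEntry_degenerate (hN : ∀ σ ≤ n, IsFlagPositive σ (N σ))
    (hrec : ∀ σ < n, ∀ i, ∀ j ≤ σ, N (σ + 1) i j = N σ i j + τ (σ + 1) j * N (σ + 1) i (j + 1))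
    (i j : ℕ) (t : ℝ) :
    curveEntry (slotControl n (τ, 0)) i j t = (if i = j then 1 else 0) +
      ∑ ρ ∈ Finset.Ioc j n, τ ρ j * (∫ u in (0 : ℝ)..t, slotBump n ρ j u) * N ρ i (j + 1) := by
  obtain ⟨d, hd⟩ : ∃ d, i ≤ j + d := ⟨i, by omega⟩
  induction d generalizing j t with
  | zero =>
    rw [Finset.sum_eq_zero, add_zero]
    · rcases hd.eq_or_lt with rfl | h
      · rw [curveEntry_self, if_pos rfl]
      · rw [curveEntry_of_lt (by omega), if_neg (by omega)]
    · intro ρ hρ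
      rw [(hN ρ (Finset.mem_Ioc.1 hρ).2).lower _ _ (by omega), mul_zero]
  | succ d ih =>
    rw [curveEntry_eq_integral, integral_slotControl_mul _ _
      (continuous_curveEntry (continuous_slotControl_right n _) _ _), zero_mul, zero_add]
    congr 1
    refine Finset.sum_congr rfl fun σ hσ => ?_
    simp only [slotBump_mul_curveEntry_of_eq hN hrec (fun t => ih (j + 1) t (by omega)) hσ,
      intervalIntegral.integral_mul_const, mul_assoc]

theorem integral_slotBump_mul_curveEntry (hN : ∀ σ ≤ n, IsFlagPositive σ (N σ))
    (hrec : ∀ σ < n, ∀ i, ∀ j ≤ σ, N (σ + 1) i j = N σ i j + τ (σ + 1) j * N (σ + 1) i (j + 1))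
    (i : ℕ) {j σ : ℕ} (hσ : σ ∈ Finset.Ioc j n) :
    ∫ u in (0 : ℝ)..(n + 1) ^ 2, slotBump n σ j u * curveEntry (slotControl n (τ, 0)) i (j + 1) u =
      N σ i (j + 1) := by
  simp only [slotBump_mul_curveEntry_of_eq hN hrec (curveEntry_degenerate hN hrec i (j + 1)) hσ,
    intervalIntegral.integral_mul_const]
  rw [Finset.mem_Ioc] at hσ
  rw [integral_slotBump_eq_one hσ.1.le (slot_add_one_le hσ.2), one_mul]

end Degenerate

/-! ### Correcting the weights after adding a positive constant -/

open Filter Topology in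
theorem Matrix.tendsto_nonsing_inv {ι X : Type*} [Fintype ι] [DecidableEq ι] {l : Filter X}
    {G : X → Matrix ι ι ℝ} {G₀ : Matrix ι ι ℝ} (hG : Tendsto G l (𝓝 G₀)) (hdet : G₀.det ≠ 0) :
    Tendsto (fun x => (G x)⁻¹) l (𝓝 G₀⁻¹) := by
  have hd : Continuous fun A : Matrix ι ι ℝ => A.det := continuous_id.matrix_det
  have ha : Continuous fun A : Matrix ι ι ℝ => A.adjugate := continuous_id.matrix_adjugate
  have hdetG : Tendsto (fun x => (G x).det) l (𝓝 G₀.det) := (hd.tendsto G₀).comp hG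
  have hadj : Tendsto (fun x => (G x).adjugate) l (𝓝 G₀.adjugate) := (ha.tendsto G₀).comp hG
  simp only [Matrix.inv_def, Ring.inverse_eq_inv']
  exact (hdetG.inv₀ hdet).smul hadj

open Filter Topology in
theorem Filter.Tendsto.matrix_mulVec {ι X : Type*} [Fintype ι] {l : Filter X}
    {A : X → Matrix ι ι ℝ} {A₀ : Matrix ι ι ℝ} {b : X → ι → ℝ} {b₀ : ι → ℝ}
    (hA : Tendsto A l (𝓝 A₀)) (hb : Tendsto b l (𝓝 b₀)) :
    Tendsto (fun x => (A x).mulVec (b x)) l (𝓝 (A₀.mulVec b₀)) := by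
  have hcont : Continuous fun q : Matrix ι ι ℝ × (ι → ℝ) => q.1.mulVec q.2 :=
    continuous_fst.matrix_mulVec continuous_snd
  exact (hcont.tendsto (A₀, b₀)).comp (hA.prodMk_nhds hb)

open Filter Topology in
theorem Matrix.tendsto_nonsing_inv_mulVec {ι X : Type*} [Fintype ι] [DecidableEq ι] {l : Filter X}
    {G : X → Matrix ι ι ℝ} {G₀ : Matrix ι ι ℝ} {b : X → ι → ℝ} {x₀ : ι → ℝ}
    (hG : Tendsto G l (𝓝 G₀)) (hdet : G₀.det ≠ 0) (hb : Tendsto b l (𝓝 (G₀.mulVec x₀))) :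
    Tendsto (fun x => (G x)⁻¹.mulVec (b x)) l (𝓝 x₀) := by
  have hmul := (tendsto_nonsing_inv hG hdet).matrix_mulVec hb
  have hx : G₀⁻¹.mulVec (G₀.mulVec x₀) = x₀ := by
    rw [Matrix.mulVec_mulVec, Matrix.nonsing_inv_mul _ (isUnit_iff_ne_zero.2 hdet),
      Matrix.one_mulVec]
  rwa [hx] at hmul

section Solve

variable {n : ℕ} {N : ℕ → ℕ → ℕ → ℝ} {τ : ℕ → ℕ → ℝ}

/-- The matrix of the linear system for the weights of the letter `j`, made square by identity
columns. -/
noncomputable def slotMatrix (n j : ℕ) (p : (ℕ → ℕ → ℝ) × ℝ) :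
    Matrix (Fin (n + 1)) (Fin (n + 1)) ℝ :=
  Matrix.of fun i σ => if j < σ then
    ∫ u in (0 : ℝ)..(n + 1) ^ 2, slotBump n σ j u * curveEntry (slotControl n p) i (j + 1) u
  else if i = σ then 1 else 0

theorem continuous_slotMatrix (n j : ℕ) : Continuous (slotMatrix n j) := by
  refine continuous_matrix fun i σ => ?_
  simp only [slotMatrix, Matrix.of_apply]
  split_ifs
  · exact intervalIntegral.continuous_parametric_intervalIntegral_of_continuous'
      (f := fun p u => slotBump n σ j u * curveEntry (slotControl n p) i (j + 1) u)
      (((continuous_slotBump n σ j).comp continuous_snd).mul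
        (continuous_curveEntry_param (fun l => continuous_slotControl n l) i (j + 1))) 0 _
  · exact continuous_const
  · exact continuous_const

/-- The right hand side of the linear system for the weights of the letter `j`. -/
noncomputable def slotVec (n j : ℕ) (M : ℕ → ℕ → ℝ) (p : (ℕ → ℕ → ℝ) × ℝ) (i : Fin (n + 1)) : ℝ :=
  M i j - (if (i : ℕ) = j then 1 else 0) -
    p.2 * ∫ u in (0 : ℝ)..(n + 1) ^ 2, curveEntry (slotControl n p) i (j + 1) u

theorem continuous_slotVec (n j : ℕ) (M : ℕ → ℕ → ℝ) : Continuous (slotVec n j M) := by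
  refine continuous_pi fun i => ?_
  unfold slotVec
  exact continuous_const.sub (continuous_snd.mul
    (intervalIntegral.continuous_parametric_intervalIntegral_of_continuous'
      (f := fun p u => curveEntry (slotControl n p) i (j + 1) u)
      (continuous_curveEntry_param (fun l => continuous_slotControl n l) i (j + 1)) 0 _))

theorem slotControl_congr {p q : (ℕ → ℕ → ℝ) × ℝ} {j : ℕ} (h : ∀ σ, p.1 σ j = q.1 σ j)
    (h2 : p.2 = q.2) : slotControl n p j = slotControl n q j := by
  ext t
  simp only [slotControl, h, h2]

/-- At `δ = 0` column `σ > j` is column `j + 1` of `N σ`, which vanishes below row `σ` and is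
positive in that row. So the matrix is upper triangular with nonzero diagonal. -/
theorem det_slotMatrix_ne_zero (hN : ∀ σ ≤ n, IsFlagPositive σ (N σ))
    (hrec : ∀ σ < n, ∀ i, ∀ j ≤ σ, N (σ + 1) i j = N σ i j + τ (σ + 1) j * N (σ + 1) i (j + 1))
    (j : ℕ) : (slotMatrix n j (τ, 0)).det ≠ 0 := by
  have hentry : ∀ i σ : Fin (n + 1), j < σ →
      slotMatrix n j (τ, 0) i σ = N σ i (j + 1) := fun i σ h => by
    rw [slotMatrix, Matrix.of_apply, if_pos h]
    exact integral_slotBump_mul_curveEntry hN hrec i (Finset.mem_Ioc.2 ⟨h, by omega⟩)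
  rw [Matrix.det_of_isUpperTriangular]
  · refine Finset.prod_ne_zero_iff.2 fun σ _ => ?_
    by_cases h : j < σ
    · rw [hentry σ σ h]
      exact ((hN σ (by omega)).last_row_pos h).ne'
    · simp [slotMatrix, h]
  · intro i σ hσi
    have hσi' : (σ : ℕ) < i := hσi
    by_cases h : j < σ
    · rw [hentry i σ h, (hN σ (by omega)).trivial_below _ _ hσi', if_neg (by omega)]
    · rw [slotMatrix, Matrix.of_apply, if_neg h, if_neg (Fin.ne_of_gt (a := σ) (b := i) hσi)]

theorem sum_Ioc_eq_sum_fin {j : ℕ} (f : ℕ → ℝ) :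
    ∑ σ ∈ Finset.Ioc j n, f σ = ∑ σ : Fin (n + 1), if j < σ then f σ else 0 := by
  rw [Fin.sum_univ_eq_sum_range fun σ => if j < σ then f σ else 0, ← Finset.sum_filter]
  refine Finset.sum_congr ?_ fun _ _ => rfl
  ext σ
  simp only [Finset.mem_Ioc, Finset.mem_filter, Finset.mem_range]
  omega

theorem slotVec_degenerate (hN : ∀ σ ≤ n, IsFlagPositive σ (N σ))
    (hrec : ∀ σ < n, ∀ i, ∀ j ≤ σ, N (σ + 1) i j = N σ i j + τ (σ + 1) j * N (σ + 1) i (j + 1))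
    {j : ℕ} (hj : j ≤ n) :
    slotVec n j (N n) (τ, 0) =
      (slotMatrix n j (τ, 0)).mulVec fun σ => if j < σ then τ σ j else 0 := by
  ext i
  rw [slotVec, factorization_eq_sum hN hrec hj le_rfl, sum_Ioc_eq_sum_fin]
  simp only [zero_mul, sub_zero, add_sub_cancel_left, Matrix.mulVec, dotProduct]
  refine Finset.sum_congr rfl fun σ _ => ?_
  split_ifs with h
  · rw [slotMatrix, Matrix.of_apply, if_pos h,
      integral_slotBump_mul_curveEntry hN hrec i (Finset.mem_Ioc.2 ⟨h, by omega⟩), mul_comm]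
  · rw [mul_zero]

theorem curveEntry_end_of_solution {j : ℕ} {p q : (ℕ → ℕ → ℝ) × ℝ} {M : ℕ → ℕ → ℝ}
    (hp2 : p.2 = q.2) (hpq : ∀ σ, ∀ l, j < l → p.1 σ l = q.1 σ l)
    (hdet : (slotMatrix n j q).det ≠ 0)
    (hsol : ∀ σ : Fin (n + 1), j < σ →
      p.1 σ j = ((slotMatrix n j q)⁻¹.mulVec (slotVec n j M q)) σ) {i : Fin (n + 1)} (hi : j < i) :
    curveEntry (slotControl n p) i j ((n + 1) ^ 2) = M i j := by
  set x := (slotMatrix n j q)⁻¹.mulVec (slotVec n j M q) with hx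
  have hcongr : curveEntry (slotControl n p) i (j + 1) = curveEntry (slotControl n q) i (j + 1) :=
    curveEntry_congr (fun l hl => slotControl_congr (fun σ => hpq σ l hl) hp2) i
  have hlin : (slotMatrix n j q).mulVec x = slotVec n j M q := by
    rw [hx, Matrix.mulVec_mulVec, Matrix.mul_nonsing_inv _ (isUnit_iff_ne_zero.2 hdet),
      Matrix.one_mulVec]
  have hrow := congrFun hlin i
  rw [slotVec, if_neg hi.ne', sub_zero, Matrix.mulVec, dotProduct] at hrow
  rw [curveEntry_eq_integral, if_neg hi.ne', zero_add, hcongr, integral_slotControl_mul _ _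
    (continuous_curveEntry (continuous_slotControl_right n _) _ _), sum_Ioc_eq_sum_fin, hp2]
  have hsum : (∑ σ : Fin (n + 1), if j < σ then p.1 σ j *
      ∫ u in (0 : ℝ)..(n + 1) ^ 2, slotBump n σ j u * curveEntry (slotControl n q) i (j + 1) u else 0) =
      ∑ σ, slotMatrix n j q i σ * x σ := by
    refine Finset.sum_congr rfl fun σ _ => ?_
    split_ifs with h
    · rw [slotMatrix, Matrix.of_apply, if_pos h, hsol σ h, mul_comm]
    · rw [slotMatrix, Matrix.of_apply, if_neg h, if_neg, zero_mul]
      rintro rfl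
      exact h hi
  rw [hsum, hrow]
  ring

-- Induction on the number `d` of columns to the left of column `n` already matched. The weights of
-- the next letter solve the system built from the weights found so far; its limit at `δ = 0` is
-- solved by `τ`, so continuity of the inverse gives convergence to `τ`.
open Filter Topology Matrix in
theorem exists_weights (hN : ∀ σ ≤ n, IsFlagPositive σ (N σ))
    (hrec : ∀ σ < n, ∀ i, ∀ j ≤ σ, N (σ + 1) i j = N σ i j + τ (σ + 1) j * N (σ + 1) i (j + 1))
    (d : ℕ) : ∃ s : ℝ → ℕ → ℕ → ℝ, Tendsto s (𝓝[>] 0) (𝓝 τ) ∧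
      ∀ᶠ δ in 𝓝[>] (0 : ℝ), ∀ j, n ≤ j + d → ∀ i ≤ n,
        curveEntry (slotControl n (s δ, δ)) i j ((n + 1) ^ 2) = N n i j := by
  have htriv : ∀ β : ℕ → ℝ → ℝ, ∀ i j t, i ≤ j → curveEntry β i j t = N n i j := by
    intro β i j t hij
    rcases hij.eq_or_lt with rfl | h
    · rw [curveEntry_self, (hN n le_rfl).diag]
    · rw [curveEntry_of_lt h, (hN n le_rfl).lower _ _ h]
  induction d with
  | zero =>
    exact ⟨fun _ => τ, tendsto_const_nhds, Eventually.of_forall fun δ j hj i hi =>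
      htriv _ _ _ _ (by omega)⟩
  | succ d ih =>
    obtain ⟨s, hs, hend⟩ := ih
    by_cases hdn : n ≤ d
    · exact ⟨s, hs, hend.mono fun δ h j hj i hi => h j (by omega) i hi⟩
    set j₀ := n - (d + 1) with hj₀
    have hp : Tendsto (fun δ : ℝ => (s δ, δ)) (𝓝[>] 0) (𝓝 (τ, 0)) :=
      hs.prodMk_nhds (tendsto_nhdsWithin_of_tendsto_nhds tendsto_id)
    have hdet₀ := det_slotMatrix_ne_zero hN hrec j₀
    have hG := ((continuous_slotMatrix n j₀).tendsto (τ, 0)).comp hp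
    have hx := Matrix.tendsto_nonsing_inv_mulVec hG hdet₀ (by
      rw [← slotVec_degenerate hN hrec (show j₀ ≤ n by omega)]
      exact ((continuous_slotVec n j₀ (N n)).tendsto (τ, 0)).comp hp)
    have hdet : ∀ᶠ δ in 𝓝[>] (0 : ℝ), (slotMatrix n j₀ (s δ, δ)).det ≠ 0 :=
      (((continuous_id.matrix_det).tendsto _).comp hG).eventually_ne hdet₀
    -- Only letter `j₀` changes, so columns to its right keep their endpoints. Weights outside `j₀ <
    -- σ ≤ n` do not enter the control; the value `τ` keeps the convergence trivial there.
    set s' : ℝ → ℕ → ℕ → ℝ := fun δ σ l => if l = j₀ then (if h : j₀ < σ ∧ σ < n + 1 then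
      ((slotMatrix n j₀ (s δ, δ))⁻¹.mulVec (slotVec n j₀ (N n) (s δ, δ))) ⟨σ, h.2⟩ else τ σ l)
      else s δ σ l with hs'
    have hs'ne : ∀ δ σ l, j₀ < l → s' δ σ l = s δ σ l := fun δ σ l hl => if_neg hl.ne'
    refine ⟨s', ?_, ?_⟩
    · refine tendsto_pi_nhds.2 fun σ => tendsto_pi_nhds.2 fun l => ?_
      by_cases hl : l = j₀
      · simp only [hs', if_pos hl]
        split_ifs with h
        · have := tendsto_pi_nhds.1 hx ⟨σ, h.2⟩
          simpa [h.1, hl] using this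
        · exact tendsto_const_nhds
      · simp only [hs', if_neg hl]
        exact tendsto_pi_nhds.1 (tendsto_pi_nhds.1 hs σ) l
    · filter_upwards [hend, hdet] with δ hδ hdetδ j hj i hi
      rcases (show j₀ ≤ j by omega).eq_or_lt with rfl | hlt
      · rcases le_or_gt i j₀ with hij | hij
        · exact htriv _ _ _ _ hij
        · refine curveEntry_end_of_solution (i := ⟨i, by omega⟩) (p := (s' δ, δ)) (q := (s δ, δ)) rfl
            (fun σ l hl => hs'ne δ σ l hl) hdetδ (fun σ hσ => ?_) hij
          simp only [hs', if_true]
          rw [dif_pos ⟨hσ, σ.2⟩]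
      · rw [← hδ j (by omega) i hi]
        exact congrFun (curveEntry_congr (fun l hl => slotControl_congr (p := (s' δ, δ))
          (q := (s δ, δ)) (fun σ => hs'ne δ σ l (by omega)) rfl) i) _

open Filter Topology Matrix in
theorem IsFlagPositive.exists_control {M : ℕ → ℕ → ℝ} (hM : IsFlagPositive n M) :
    ∃ β : ℕ → ℝ → ℝ, (∀ j, Continuous (β j)) ∧ (∀ j t, 0 < β j t) ∧
      ∀ i ≤ n, ∀ j, curveEntry β i j ((n + 1) ^ 2) = M i j := by
  obtain ⟨N, τ, rfl, hN, hτ, hrec⟩ := hM.exists_factorization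
  obtain ⟨s, hs, hend⟩ := exists_weights hN hrec n
  have hpos : ∀ᶠ δ in 𝓝[>] (0 : ℝ), ∀ σ ∈ Finset.range (n + 1), ∀ j ∈ Finset.range σ,
      0 < s δ σ j := by
    refine (Finset.eventually_all _).2 fun σ hσ => (Finset.eventually_all _).2 fun j hj => ?_
    rw [Finset.mem_range] at hσ hj
    obtain ⟨σ, rfl⟩ : ∃ ρ, σ = ρ + 1 := ⟨σ - 1, by omega⟩
    exact (tendsto_pi_nhds.1 (tendsto_pi_nhds.1 hs _) j).eventually_const_lt
      (hτ σ (by omega) j (by omega))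
  obtain ⟨δ, hδ, hδpos, hδ0⟩ := (hend.and (hpos.and self_mem_nhdsWithin)).exists
  refine ⟨slotControl n (s δ, δ), continuous_slotControl_right n _, fun j t => ?_,
    fun i hi j => hδ j (by omega) i hi⟩
  refine add_pos_of_pos_of_nonneg hδ0 (Finset.sum_nonneg fun σ hσ => ?_)
  rw [Finset.mem_Ioc] at hσ
  exact mul_nonneg (hδpos σ (by simp; omega) j (by simp; omega)).le (bump_nonneg _)

end Solve

/-! ### The convex curve and the equivalence -/

theorem IsTotallyPositive.exists_isConvexCurve {n : ℕ}
    {L₀ L : Matrix (Fin (n + 1)) (Fin (n + 1)) ℝ} (hL₀ : L₀ ∈ unipotentLower n)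
    (hL : IsTotallyPositive L) :
    ∃ Γ : ℝ → Matrix (Fin (n + 1)) (Fin (n + 1)) ℝ,
      IsConvexCurve Γ 0 1 ∧ Γ 0 = L₀ ∧ Γ 1 = L₀ * L := by
  obtain ⟨β, hβ, hpos, hend⟩ := hL.isFlagPositive.exists_control
  -- The curve lives on `[0, T]`; rescaling time to `[0, 1]` multiplies the controls by `T`.
  set T : ℝ := (n + 1) ^ 2 with hT
  have hTpos : 0 < T := by positivity
  set C : ℝ → Matrix (Fin (n + 1)) (Fin (n + 1)) ℝ := fun t =>
    Matrix.of fun i j => curveEntry β i j (t * T) with hC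
  have hCmem : ∀ t, C t ∈ unipotentLower n := fun t =>
    ⟨fun i j h => curveEntry_of_lt h _, fun i => curveEntry_self _ _ _⟩
  have hCext : ∀ t i j, extendCol (C t) i j = curveEntry β i j (t * T) := by
    intro t i j
    rw [extendCol]
    split_ifs with h
    · rfl
    · exact (curveEntry_of_lt (by omega) _).symm
  have hder : ∀ t i k, HasDerivAt (fun s => (L₀ * C s) i k)
      (((L₀ * C t) * ∑ j : Fin n, (T * β j (t * T)) • subdiagonalUnit j) i k) t := by
    intro t i k
    rw [Matrix.mul_assoc]
    simp only [Matrix.mul_apply (M := L₀)]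
    refine HasDerivAt.fun_sum fun l _ => HasDerivAt.const_mul _ ?_
    rw [mul_sum_subdiagonalUnit (C t) (fun j => T * β j (t * T)), hCext]
    have h1 := (hasDerivAt_curveEntry hβ l k (t * T)).comp t ((hasDerivAt_id t).mul_const T)
    convert! h1 using 1
    simp only [one_mul]
    ring
  have hmem : ∀ t, L₀ * C t ∈ unipotentLower n := fun t => mul_mem_unipotentLower hL₀ (hCmem t)
  refine ⟨fun t => L₀ * C t, ⟨fun t _ => hmem t, fun i k => ?_, fun t ht D hD => ?_⟩, ?_, ?_⟩
  · refine ContDiffOn.absolutelyContinuousOnInterval (ContDiff.contDiffOn ?_)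
    simp only [Matrix.mul_apply]
    refine ContDiff.sum fun l _ => contDiff_const.mul ?_
    refine ContDiff.comp (g := curveEntry β l k) ?_ (contDiff_id.mul contDiff_const)
    refine contDiff_one_iff_deriv.2 ⟨fun t => (hasDerivAt_curveEntry hβ l k t).differentiableAt, ?_⟩
    rw [funext fun t => (hasDerivAt_curveEntry hβ l k t).deriv]
    exact (hβ k).mul (continuous_curveEntry hβ l (k + 1))
  · refine ⟨fun j => T * β j (t * T), fun j => mul_pos hTpos (hpos _ _), ?_⟩
    have hDeq : D = (L₀ * C t) * ∑ j : Fin n, (T * β j (t * T)) • subdiagonalUnit j := by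
      ext i k
      -- Derivatives within `[0, 1]` are unique, also at the end points, so `D` must be the
      -- derivative already computed.
      exact (uniqueDiffOn_Icc zero_lt_one t ht).eq_deriv _ (hD i k) (hder t i k).hasDerivWithinAt
    rw [hDeq, Matrix.nonsing_inv_mul_cancel_left _ _ (isUnit_det_of_mem_unipotentLower (hmem t))]
  · have : C 0 = 1 := by
      ext i j
      simp only [hC, Matrix.of_apply, zero_mul]
      rw [curveEntry_eq_integral, intervalIntegral.integral_same, add_zero, Matrix.one_apply]
      simp only [Fin.ext_iff]
    simp only [this, mul_one]
  · have : C 1 = L := by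
      ext i j
      simp only [hC, Matrix.of_apply, one_mul]
      rw [hend i (by omega), extendArray, dif_pos ⟨i.2, j.2⟩]
    simp only [this]

theorem lemma4p5 (n : ℕ) (L₀ L₁ : Matrix (Fin (n + 1)) (Fin (n + 1)) ℝ)
    (hL₀ : L₀ ∈ unipotentLower n) (hL₁ : L₁ ∈ unipotentLower n) :
    IsTotallyPositive (L₀⁻¹ * L₁) ↔
      ∃ Γ : ℝ → Matrix (Fin (n + 1)) (Fin (n + 1)) ℝ,
        IsConvexCurve Γ 0 1 ∧ Γ 0 = L₀ ∧ Γ 1 = L₁ := by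
  refine ⟨fun h => ?_, ?_⟩
  · simpa only [Matrix.mul_nonsing_inv_cancel_left L₀ L₁ (isUnit_det_of_mem_unipotentLower hL₀)]
      using h.exists_isConvexCurve hL₀
  · rintro ⟨Γ, hΓ, rfl, rfl⟩
    exact hΓ.isTotallyPositive
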